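/- Let $G$ be a finite group and let $S=(\mathcal X,\mathcal Y)$ be a supercharacter theory of $G$: $\mathcal X$ is a partition of the set $\mathrm{Irr}(G)$ of irreducible complex characters, $\mathcal Y$ is a partition of $G$ with $\{1\}\in\mathcal Y$ and $|\mathcal X|=|\mathcal Y|$, and for each $X\in\mathcal X$ the supercharacter $\sigma_X=\sum_{\chi\in X}\chi(1)\chi$ is constant on each superclass $K\in\mathcal Y$. Write $\mathrm{Irr}(S)=\{\sigma_X: X\in\mathcal X\}$ and $\mathrm{Cl}(S)=\mathcal Y$. A subgroup of $G$ is called $S$-normal if it is a union of members of $\mathrm{Cl}(S)$. For an $S$-normal subgroup $N$, let $\mathrm{Irr}(S\mid N)$ be the set of $\sigma\in\mathrm{Irr}(S)$ with $N\not\le\ker\sigma$, let $$V(S\mid N)=\langle g\in G : \sigma(g)\ne 0\text{ for some }\sigma\in \mathrm{Irr}(S\mid N)\rangle ,$$ and let $U(S\mid N)$ be the product of all $S$-normal subgroups $H$ of $G$ with $V(S\mid H)\le N$. For $S$-normal $H\le N$, with canonical map $\pi:G\to G/H$, the restriction $S_N$ is the supercharacter theory of $N$ with superclasses $\{K\in\mathrm{Cl}(S):K\subseteq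 N\}$, and the deflation $S^{G/H}$ is the supercharacter theory of $G/H$ with superclasses $\{\pi(K):K\in\mathrm{Cl}(S)\}$. Their $\Delta$-product over $H$ and $N$, denoted $S_N\,\Delta\,S^{G/H}$, is the supercharacter theory of $G$ whose superclasses are the $S_N$-classes together with the sets $\pi^{-1}(L)$, where $L$ is an $S^{G/H}$-class not contained in $N/H$. As a supercharacter theory is determined by its superclasses, $S=S_N\,\Delta\,S^{G/H}$ means that these sets are exactly the members of $\mathrm{Cl}(S)$. **Theorem.** Let $N>1$ be an $S$-normal subgroup of $G$. There exists a nontrivial $S$-normal subgroup $H$ of $G$ with $H\le N$ and $S=S_N\,\Delta\,S^{G/H}$ if and only if $U(S\mid N)>1$. -/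

import Mathlib

noncomputable section

/-- The set `Irr(G)` of irreducible complex characters of `G`, as functions `G → ℂ`. Every
finite-dimensional complex representation is isomorphic to one on some `ℂⁿ`. -/
def irrCharacters (G : Type*) [Group G] : Set (G → ℂ) :=
  {χ | ∃ (n : ℕ) (ρ : Representation ℂ G (Fin n → ℂ)), ρ.IsIrreducible ∧ ρ.character = χ}

/-- The function `σ_X = ∑_{χ ∈ X} χ(1) χ` attached to a set `X` of irreducible characters. -/
def sigmaChar {G : Type*} [Group G] (X : Set (irrCharacters G)) (g : G) : ℂ :=
  ∑ᶠ χ ∈ X, (χ : G → ℂ) 1 * (χ : G → ℂ) g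

/-- A supercharacter theory `(𝒳, 𝒴)` of a (finite) group in the sense of Diaconis and Isaacs. -/
structure SupercharacterTheory (G : Type*) [Group G] where
  /-- The partition of `Irr(G)`. -/
  charParts : Set (Set (irrCharacters G))
  /-- The partition `Cl(S)` of `G` into superclasses. -/
  classes : Set (Set G)
  charParts_isPartition : Setoid.IsPartition charParts
  classes_isPartition : Setoid.IsPartition classes
  singleton_one_mem : {(1 : G)} ∈ classes
  encard_eq : charParts.encard = classes.encard
  sigmaChar_const : ∀ X ∈ charParts, ∀ K ∈ classes, ∀ g ∈ K, ∀ h ∈ K,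
    sigmaChar X g = sigmaChar X h

namespace SupercharacterTheory

variable {G : Type*} [Group G]

/-- The set `Irr(S)` of supercharacters of `S`. -/
def superchars (S : SupercharacterTheory G) : Set (G → ℂ) :=
  {σ | ∃ X ∈ S.charParts, sigmaChar X = σ}

/-- The kernel of a character, as a set. -/
def charKer (σ : G → ℂ) : Set G :=
  {g | σ g = σ 1}

/-- `Irr(S | N)`: the supercharacters whose kernel does not contain `N`. -/
def supercharsOver (S : SupercharacterTheory G) (N : Subgroup G) : Set (G → ℂ) :=
  {σ | σ ∈ S.superchars ∧ ¬ (N : Set G) ⊆ charKer σ}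

/-- A subgroup is `S`-normal if it is a union of `S`-classes. -/
def IsSNormal (S : SupercharacterTheory G) (N : Subgroup G) : Prop :=
  ∃ 𝒦 ⊆ S.classes, (N : Set G) = ⋃₀ 𝒦

/-- `V(S | N)`: the subgroup generated by the elements at which some member of `Irr(S | N)` does
not vanish. -/
def vanishingOff (S : SupercharacterTheory G) (N : Subgroup G) : Subgroup G :=
  Subgroup.closure {g | ∃ σ ∈ S.supercharsOver N, σ g ≠ 0}

/-- `U(S | N)`: the product of all `S`-normal subgroups `H` with `V(S | H) ≤ N`. `S`-normal
subgroups are normal, so their product is their join in the lattice of subgroups. -/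
def uSubgroup (S : SupercharacterTheory G) (N : Subgroup G) : Subgroup G :=
  sSup {H | S.IsSNormal H ∧ S.vanishingOff H ≤ N}

/-- The superclasses of the restriction `S_N`: the `S`-classes contained in `N`, viewed as subsets
of `N`. -/
def restrictClasses (S : SupercharacterTheory G) (N : Subgroup G) : Set (Set N) :=
  {A | ((↑) : N → G) '' A ∈ S.classes}

/-- The superclasses of the deflation `S^{G/H}`: the images of the `S`-classes in `G / H`. -/
def deflateClasses (S : SupercharacterTheory G) (H : Subgroup G) : Set (Set (G ⧸ H)) :=
  {B | ∃ K ∈ S.classes, (QuotientGroup.mk : G → G ⧸ H) '' K = B}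

/-- The superclasses of the `Δ`-product `C Δ D` over `H` and `N` (with `H ≤ N`), in terms of the
superclasses `𝒞` of a supercharacter theory `C` of `N` and the superclasses `𝒟` of a supercharacter
theory `D` of `G / H`: the `C`-classes, and the preimages in `G` of the `D`-classes outside
`N / H`. -/
def deltaClasses (H N : Subgroup G) (𝒞 : Set (Set N)) (𝒟 : Set (Set (G ⧸ H))) : Set (Set G) :=
  {K | ∃ A ∈ 𝒞, K = ((↑) : N → G) '' A} ∪
  {K | ∃ B ∈ 𝒟, ¬ B ⊆ (QuotientGroup.mk : G → G ⧸ H) '' (N : Set G) ∧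
    K = (QuotientGroup.mk : G → G ⧸ H) ⁻¹' B}

/-- The conditions under which the `Δ`-product over `H` and `N` of supercharacter theories `C` of
`N` and `D` of `G / H` is defined, in terms of their superclasses: `H ≤ N` are normal in `G`, `C` is
`G`-invariant, `H` is `C`-normal, `N / H` is `D`-normal, and `C^{N/H} = D_{N/H}`. -/
structure DeltaCompatible (H N : Subgroup G) (𝒞 : Set (Set N)) (𝒟 : Set (Set (G ⧸ H))) :
    Prop where
  le : H ≤ N
  normal_left : H.Normal
  normal_right : N.Normal
  invariant : ∀ A ∈ 𝒞, ∀ x ∈ A, ∀ (g : G) (y : N), (y : G) = g * x * g⁻¹ → y ∈ A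
  left_union : ∃ 𝒦 ⊆ 𝒞, {x : N | (x : G) ∈ H} = ⋃₀ 𝒦
  right_union : ∃ ℒ ⊆ 𝒟, (QuotientGroup.mk : G → G ⧸ H) '' (N : Set G) = ⋃₀ ℒ
  agree : {B | ∃ A ∈ 𝒞, (fun x : N => (QuotientGroup.mk (x : G) : G ⧸ H)) '' A = B} =
    {B | B ∈ 𝒟 ∧ B ⊆ (QuotientGroup.mk : G → G ⧸ H) '' (N : Set G)}

/-- `S = S_N Δ S^{G/H}`: the `Δ`-product of the restriction `S_N` and the deflation `S^{G/H}` is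
defined and equals `S`. A supercharacter theory is determined by its superclasses, and `S_N`,
`S^{G/H}` and the `Δ`-product are the theories with the superclasses given above. -/
def IsDeltaProduct (S : SupercharacterTheory G) (H N : Subgroup G) : Prop :=
  DeltaCompatible H N (S.restrictClasses N) (S.deflateClasses H) ∧
    S.classes = deltaClasses H N (S.restrictClasses N) (S.deflateClasses H)

end SupercharacterTheory

end

/-!
For an `S`-normal subgroup `H ≤ N`, both sides of the equivalence express that every superclass
outside `N` is a union of cosets of `H`.

By orthogonality of irreducible characters the supercharacters form a basis of the functions that
are constant on superclasses (`IsClassFunction.exists_eq_sum`). Expanding indicator functions of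
superclasses shows that superclasses are closed under conjugation, so that `S`-normal subgroups are
normal.

For an irreducible character `χ` afforded by `ρ` and a normal subgroup `H`, Schur's lemma applied to
`∑ h ∈ H, ρ h` shows that either all sums of `χ` over cosets of `H` vanish or `χ` is constant on
these cosets. If `H` is `S`-normal, expanding the indicator function of `H` in supercharacters shows
that the same alternative holds for all `χ` in a part of `Irr(G)`, hence for the corresponding
supercharacter (`IsSNormal.sigmaChar_coset_dichotomy`). The members of `Irr(S | H)` are exactly the
supercharacters whose coset sums vanish.

Consequently, if all of `Irr(S | H)` vanishes at `g`, then `∑ h ∈ H, f (g * h) = |H| f g` for every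
`f` that is constant on superclasses (`IsClassFunction.sum_coset`). For the indicator function of
`1` this gives `H ≤ V(S | H)`; for that of a superclass `K` containing `g` it gives `g * H ⊆ K`.
So a nontrivial `S`-normal `H` with `V(S | H) ≤ N`, which exists exactly when `U(S | N)` is
nontrivial, lies in `N`, and superclasses outside `N` are unions of its cosets. Conversely, if
superclasses outside `N` are unions of cosets of `H`, a member of `Irr(S | H)` is constant with sum
zero on each coset outside `N`, hence vanishes there, and `V(S | H) ≤ N`.
-/

namespace SupercharacterTheory

open Finset

/-! ### Irreducible characters and normal subgroups -/

section Characters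

variable {G : Type*} [Group G]

theorem irrCharacters_conj {χ : G → ℂ} (hχ : χ ∈ irrCharacters G) (g x : G) :
    χ (g * x * g⁻¹) = χ x := by
  obtain ⟨n, ρ, -, rfl⟩ := hχ
  exact ρ.char_conj x g

theorem exists_irrCharacters_one_eq {χ : G → ℂ} (hχ : χ ∈ irrCharacters G) :
    ∃ n : ℕ, 0 < n ∧ χ 1 = n := by
  obtain ⟨n, ρ, hρ, rfl⟩ := hχ
  refine ⟨n, Nat.pos_of_ne_zero ?_, by simp⟩
  rintro rfl
  obtain ⟨a, b, hab⟩ := hρ.toNontrivial.exists_pair_ne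
  exact hab (Subrepresentation.toSubmodule_injective (Subsingleton.elim _ _))

theorem irrCharacters_one_ne_zero {χ : G → ℂ} (hχ : χ ∈ irrCharacters G) : χ 1 ≠ 0 := by
  obtain ⟨n, hn, h⟩ := exists_irrCharacters_one_eq hχ
  rw [h]
  exact_mod_cast hn.ne'

/-- The coset sums of an irreducible character over a normal subgroup `H`: the operator
`∑ h ∈ H, ρ h` is an intertwining endomorphism of `ρ`, hence zero or surjective, and in the second
case `H` acts trivially. -/
theorem irrCharacters_coset_dichotomy (H : Subgroup G) [H.Normal] [Fintype H] {χ : G → ℂ}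
    (hχ : χ ∈ irrCharacters G) :
    (∀ g, ∑ h : H, χ (g * h) = 0) ∨ ∀ g, ∀ h ∈ H, χ (g * h) = χ g := by
  obtain ⟨n, ρ, hρ, rfl⟩ := hχ
  let P : Representation.IntertwiningMap ρ ρ :=
    { toLinearMap := ∑ h : H, ρ h
      isIntertwining' := fun g => by
        rw [← Module.End.mul_eq_comp, ← Module.End.mul_eq_comp, Finset.sum_mul, Finset.mul_sum]
        refine Fintype.sum_equiv (MulAut.conjNormal g⁻¹).toEquiv _ _ fun h => ?_
        rw [← map_mul, ← map_mul]
        congr 1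
        simp [mul_assoc] }
  rcases Representation.IsIrreducible.surjective_or_eq_zero P with hP | hP
  · right
    intro g h hh
    have key : ρ h = 1 := by
      refine LinearMap.ext fun v => ?_
      obtain ⟨w, rfl⟩ := hP v
      change ρ h ((∑ k : H, ρ k) w) = (∑ k : H, ρ k) w
      rw [← Module.End.mul_apply, Finset.mul_sum]
      congr 1
      refine Fintype.sum_equiv (Equiv.mulLeft (⟨h, hh⟩ : H)) _ _ fun k => ?_
      simp
    simp [Representation.character, key]
  · left
    intro g
    have h0 : ∑ h : H, ρ h = 0 := congrArg (·.toLinearMap) hP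
    simp only [Representation.character, map_mul]
    rw [← map_sum, ← Finset.mul_sum, h0, mul_zero, map_zero]

open Classical in
theorem sigmaChar_eq_sum [Fintype (irrCharacters G)] (X : Set (irrCharacters G)) :
    sigmaChar X = ∑ χ with χ ∈ X, (χ : G → ℂ) 1 • (χ : G → ℂ) := by
  ext g
  rw [sigmaChar, finsum_mem_eq_finite_toFinset_sum _ X.toFinite, Finset.sum_apply]
  refine Finset.sum_congr (by ext; simp) fun χ _ => rfl

theorem sigmaChar_conj (X : Set (irrCharacters G)) (g x : G) :
    sigmaChar X (g * x * g⁻¹) = sigmaChar X x := by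
  simp only [sigmaChar, irrCharacters_conj (Subtype.prop _)]

variable [Fintype G]

/-- The pairing `|G|⁻¹ ∑ x, f x * f' x⁻¹`. It agrees with the Hermitian inner product on characters
and is bilinear on all functions. -/
noncomputable def charPairing : (G → ℂ) →ₗ[ℂ] (G → ℂ) →ₗ[ℂ] ℂ :=
  LinearMap.mk₂ ℂ (fun f f' => (Nat.card G : ℂ)⁻¹ * ∑ x, f x * f' x⁻¹)
    (fun f₁ f₂ f' => by simp [add_mul, Finset.sum_add_distrib, mul_add])
    (fun c f f' => by simp [Finset.mul_sum, mul_assoc, mul_left_comm])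
    (fun f f₁ f₂ => by simp [Finset.sum_add_distrib, mul_add])
    (fun c f f' => by simp [Finset.mul_sum, mul_left_comm])

theorem charPairing_apply (f f' : G → ℂ) :
    charPairing f f' = (Nat.card G : ℂ)⁻¹ * ∑ x, f x * f' x⁻¹ := rfl

open Classical in
theorem charPairing_irrCharacters (χ ψ : irrCharacters G) :
    charPairing (χ : G → ℂ) (ψ : G → ℂ) = if χ = ψ then 1 else 0 := by
  obtain ⟨-, n, ρ, hρ, rfl⟩ := χ
  obtain ⟨-, m, τ, hτ, rfl⟩ := ψ
  have : Invertible (Nat.card G : ℂ) := invertibleOfNonzero (by simp)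
  rw [charPairing_apply, Representation.char_orthonormal]
  by_cases h : ρ.character = τ.character
  · rw [if_pos (Subtype.ext h), if_pos]
    -- Without an isomorphism the pairing would vanish, but the pairing of `ρ` with itself is `1`.
    by_contra hne
    have h1 := Representation.char_orthonormal ρ τ
    rw [if_neg hne, ← h, Representation.char_orthonormal ρ ρ,
      if_pos ⟨Representation.Equiv.refl ρ⟩] at h1
    exact one_ne_zero h1
  · rw [if_neg (fun e => h (congrArg Subtype.val e)), if_neg]
    rintro ⟨φ⟩
    exact h (Representation.char_iso φ).symm

theorem finite_irrCharacters : Finite (irrCharacters G) := by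
  classical
  have hli : LinearIndependent ℂ (fun χ : irrCharacters G => (χ : G → ℂ)) := by
    rw [linearIndependent_iff']
    intro s c hc ψ hψ
    have h := congrArg (fun f => charPairing f (ψ : G → ℂ)) hc
    simpa [map_sum, LinearMap.sum_apply, charPairing_irrCharacters, hψ] using h
  exact hli.finite

open Classical in
theorem charPairing_sigmaChar (X : Set (irrCharacters G)) (χ : irrCharacters G) :
    charPairing (sigmaChar X) (χ : G → ℂ) = if χ ∈ X then (χ : G → ℂ) 1 else 0 := by
  have := finite_irrCharacters (G := G)
  have := Fintype.ofFinite (irrCharacters G)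
  rw [sigmaChar_eq_sum]
  simp [map_sum, LinearMap.sum_apply, charPairing_irrCharacters]

theorem sigmaChar_one_ne_zero {X : Set (irrCharacters G)} (hX : X.Nonempty) :
    sigmaChar X 1 ≠ 0 := by
  classical
  have := finite_irrCharacters (G := G)
  have := Fintype.ofFinite (irrCharacters G)
  choose d hd0 hd using fun χ : irrCharacters G => exists_irrCharacters_one_eq χ.2
  obtain ⟨χ, hχ⟩ := hX
  have h : sigmaChar X 1 = ((∑ χ with χ ∈ X, d χ * d χ : ℕ) : ℂ) := by
    rw [sigmaChar_eq_sum]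
    simp [Finset.sum_apply, hd]
  rw [h, Nat.cast_ne_zero]
  refine (Finset.sum_pos (fun χ _ => Nat.mul_pos (hd0 χ) (hd0 χ)) ⟨χ, by simpa using hχ⟩).ne'

end Characters

/-! ### Functions constant on superclasses -/

section ClassFunctions

variable {G : Type*} [Group G] (S : SupercharacterTheory G)

/-- A function on `G` that is constant on each `S`-class. -/
def IsClassFunction (f : G → ℂ) : Prop :=
  ∀ K ∈ S.classes, ∀ g ∈ K, ∀ h ∈ K, f g = f h

variable {S}

theorem exists_mem_classes (S : SupercharacterTheory G) (g : G) : ∃ K ∈ S.classes, g ∈ K :=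
  (S.classes_isPartition.2 g).exists

theorem classes_eq_of_mem {K L : Set G} (hK : K ∈ S.classes) (hL : L ∈ S.classes) {g : G}
    (hgK : g ∈ K) (hgL : g ∈ L) : K = L :=
  (S.classes_isPartition.2 g).unique ⟨hK, hgK⟩ ⟨hL, hgL⟩

theorem nonempty_of_mem_classes {K : Set G} (hK : K ∈ S.classes) : K.Nonempty :=
  Set.nonempty_iff_ne_empty.2 fun h => S.classes_isPartition.1 (h ▸ hK)

theorem IsSNormal.subset_of_mem {N : Subgroup G} (hN : S.IsSNormal N) {K : Set G}
    (hK : K ∈ S.classes) {g : G} (hgK : g ∈ K) (hgN : g ∈ N) : K ⊆ N := by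
  obtain ⟨𝒦, h𝒦, hN⟩ := hN
  rw [← SetLike.mem_coe, hN] at hgN
  obtain ⟨L, hL, hgL⟩ := hgN
  rw [classes_eq_of_mem hK (h𝒦 hL) hgK hgL, hN]
  exact Set.subset_sUnion_of_mem hL

theorem eq_zero_of_notMem_vanishingOff {H : Subgroup G} {g : G} (hg : g ∉ S.vanishingOff H)
    {σ : G → ℂ} (hσ : σ ∈ S.supercharsOver H) : σ g = 0 := by
  by_contra h
  exact hg (Subgroup.subset_closure ⟨σ, hσ, h⟩)

theorem nonempty_of_mem_charParts {X : Set (irrCharacters G)} (hX : X ∈ S.charParts) :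
    X.Nonempty :=
  Set.nonempty_iff_ne_empty.2 fun h => S.charParts_isPartition.1 (h ▸ hX)

theorem mem_charPart_iff {X : S.charParts} {χ : irrCharacters G} (hχ : χ ∈ X.1)
    (Y : S.charParts) : χ ∈ Y.1 ↔ Y = X :=
  ⟨fun h => Subtype.ext ((S.charParts_isPartition.2 χ).unique ⟨Y.2, h⟩ ⟨X.2, hχ⟩),
    fun h => h ▸ hχ⟩

open Classical in
theorem isClassFunction_indicator {A : Set G}
    (hA : ∀ K ∈ S.classes, ∀ g ∈ K, g ∈ A → K ⊆ A) :
    S.IsClassFunction (A.indicator 1) := by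
  intro K hK g hg h hh
  have : g ∈ A ↔ h ∈ A := ⟨fun hgA => hA K hK g hg hgA hh, fun hhA => hA K hK h hh hhA hg⟩
  simp [Set.indicator_apply, this]

theorem isClassFunction_indicator_of_mem_classes {K : Set G} (hK : K ∈ S.classes) :
    S.IsClassFunction (K.indicator 1) :=
  isClassFunction_indicator fun _ hL _ hy hyK => (classes_eq_of_mem hL hK hy hyK).subset

variable [Finite G]

theorem finite_charParts (S : SupercharacterTheory G) : Finite S.charParts := by
  have h : S.charParts.encard < ⊤ := by
    rw [S.encard_eq]
    exact S.classes.toFinite.encard_lt_top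
  exact (Set.encard_lt_top_iff.1 h).to_subtype

/-- The supercharacters span the functions constant on superclasses: they are linearly independent
by orthogonality of irreducible characters, and there are as many of them as superclasses. -/
theorem IsClassFunction.exists_eq_sum [Fintype S.charParts] {f : G → ℂ}
    (hf : S.IsClassFunction f) :
    ∃ c : S.charParts → ℂ, f = ∑ X, c X • sigmaChar X.1 := by
  classical
  have := Fintype.ofFinite G
  have := Fintype.ofFinite S.classes
  choose r hr using fun K : S.classes => nonempty_of_mem_classes K.2
  choose cl hcl hmem using S.exists_mem_classes
  have hrep : ∀ f' : G → ℂ, S.IsClassFunction f' → ∀ g, f' g = f' (r ⟨cl g, hcl g⟩) :=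
    fun f' hf' g => hf' _ (hcl g) _ (hmem g) _ (hr ⟨cl g, hcl g⟩)
  have hσ : ∀ X : S.charParts, S.IsClassFunction (sigmaChar X.1) :=
    fun X => S.sigmaChar_const X.1 X.2
  have hli : LinearIndependent ℂ
      (fun (X : S.charParts) (K : S.classes) => sigmaChar X.1 (r K)) := by
    rw [Fintype.linearIndependent_iff]
    intro c hc X
    have h0 : ∑ Y, c Y • sigmaChar Y.1 = 0 := by
      ext g
      have := congrFun hc ⟨cl g, hcl g⟩
      simp only [Finset.sum_apply, Pi.smul_apply, Pi.zero_apply] at this ⊢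
      rw [← this]
      exact Finset.sum_congr rfl fun Y _ => by rw [hrep _ (hσ Y) g]
    obtain ⟨χ, hχ⟩ := nonempty_of_mem_charParts X.2
    have h1 := congrArg (fun f => charPairing f (χ : G → ℂ)) h0
    simpa [map_sum, LinearMap.sum_apply, charPairing_sigmaChar, mem_charPart_iff hχ,
      irrCharacters_one_ne_zero χ.2] using h1
  have hcard : Fintype.card S.charParts = Module.finrank ℂ (S.classes → ℂ) := by
    rw [Module.finrank_fintype_fun_eq_card, ← Nat.card_eq_fintype_card,
      ← Nat.card_eq_fintype_card, Nat.card_coe_set_eq, Nat.card_coe_set_eq,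
      Set.ncard, Set.ncard, S.encard_eq]
  have hspan : (fun K : S.classes => f (r K)) ∈ Submodule.span ℂ
      (Set.range fun (X : S.charParts) (K : S.classes) => sigmaChar X.1 (r K)) := by
    rw [hli.span_eq_top_of_card_eq_finrank' hcard]
    trivial
  obtain ⟨c, hc⟩ := (Submodule.mem_span_range_iff_exists_fun ℂ).1 hspan
  refine ⟨c, funext fun g => ?_⟩
  have := congrFun hc ⟨cl g, hcl g⟩
  simp only [Finset.sum_apply, Pi.smul_apply] at this ⊢
  rw [hrep f hf g, ← this]
  exact Finset.sum_congr rfl fun Y _ => by rw [hrep _ (hσ Y) g]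

theorem IsClassFunction.conj {f : G → ℂ} (hf : S.IsClassFunction f) (g x : G) :
    f (g * x * g⁻¹) = f x := by
  have := S.finite_charParts
  have := Fintype.ofFinite S.charParts
  obtain ⟨c, rfl⟩ := hf.exists_eq_sum
  simp [Finset.sum_apply, sigmaChar_conj]

theorem conj_mem_of_mem_classes {K : Set G} (hK : K ∈ S.classes) {x : G} (hx : x ∈ K) (g : G) :
    g * x * g⁻¹ ∈ K := by
  classical
  have h := (isClassFunction_indicator_of_mem_classes hK).conj g x
  by_contra hn
  simp [hx, hn] at h

theorem IsSNormal.normal {H : Subgroup G} (hH : S.IsSNormal H) : H.Normal where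
  conj_mem x hx g := by
    obtain ⟨K, hK, hxK⟩ := S.exists_mem_classes x
    exact hH.subset_of_mem hK hxK hx (conj_mem_of_mem_classes hK hxK g)

/-- The dichotomy for irreducible characters over an `S`-normal subgroup `H` is uniform on the parts
of `Irr(G)`: the indicator function of `H` is a combination of supercharacters, so its pairing with
`χ` is the same multiple of `χ 1` for all `χ` in a part, and this multiple tells the two cases
apart. -/
theorem IsSNormal.sigmaChar_coset_dichotomy {H : Subgroup G} [Fintype H] (hH : S.IsSNormal H)
    {X : Set (irrCharacters G)} (hX : X ∈ S.charParts) :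
    (∀ g, ∑ h : H, sigmaChar X (g * h) = 0) ∨
      ∀ g, ∀ h ∈ H, sigmaChar X (g * h) = sigmaChar X g := by
  classical
  have := Fintype.ofFinite G
  have := S.finite_charParts
  have := Fintype.ofFinite S.charParts
  have := finite_irrCharacters (G := G)
  have := Fintype.ofFinite (irrCharacters G)
  have := hH.normal
  obtain ⟨c, hc⟩ := (isClassFunction_indicator (S := S) (A := H) fun K hK g hg hgH =>
    hH.subset_of_mem hK hg hgH).exists_eq_sum
  have hpair : ∀ χ ∈ X, charPairing ((H : Set G).indicator 1) (χ : G → ℂ) =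
      c ⟨X, hX⟩ * (χ : G → ℂ) 1 := by
    intro χ hχ
    rw [hc]
    simp [map_sum, LinearMap.sum_apply, charPairing_sigmaChar,
      mem_charPart_iff (X := ⟨X, hX⟩) hχ]
  have hpair' : ∀ χ : G → ℂ, charPairing ((H : Set G).indicator 1) χ =
      (Nat.card G : ℂ)⁻¹ * ∑ h : H, χ (1 * h) := by
    intro χ
    rw [charPairing_apply]
    congr 1
    have h1 : ∀ x, (H : Set G).indicator (1 : G → ℂ) x * χ x⁻¹ =
        if x ∈ H then χ x⁻¹ else 0 := fun x => by simp [Set.indicator_apply]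
    simp_rw [h1]
    rw [← Finset.sum_filter, Finset.sum_subtype (p := (· ∈ H)) _ (by simp)]
    exact Fintype.sum_equiv (Equiv.inv H) _ _ fun h => by simp
  by_cases h0 : c ⟨X, hX⟩ = 0
  · left
    have hz : ∀ χ ∈ X, ∀ g, ∑ h : H, (χ : G → ℂ) (g * h) = 0 := by
      intro χ hχ
      refine (irrCharacters_coset_dichotomy H χ.2).resolve_right fun h => ?_
      have h1 := hpair χ hχ
      rw [h0, zero_mul, hpair', Finset.sum_congr rfl fun (k : H) _ => h 1 k k.2] at h1
      simp [irrCharacters_one_ne_zero χ.2] at h1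
    intro g
    simp only [sigmaChar_eq_sum, Finset.sum_apply, Pi.smul_apply]
    rw [Finset.sum_comm]
    refine Finset.sum_eq_zero fun χ hχ => ?_
    rw [← Finset.smul_sum, hz χ (by simpa using hχ), smul_zero]
  · right
    have hz : ∀ χ ∈ X, ∀ g, ∀ h ∈ H, (χ : G → ℂ) (g * h) = (χ : G → ℂ) g := by
      intro χ hχ
      refine (irrCharacters_coset_dichotomy H χ.2).resolve_left fun h => ?_
      have h1 := hpair χ hχ
      rw [hpair', h 1, mul_zero] at h1
      exact mul_ne_zero h0 (irrCharacters_one_ne_zero χ.2) h1.symm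
    intro g h hh
    simp only [sigmaChar_eq_sum, Finset.sum_apply, Pi.smul_apply]
    exact Finset.sum_congr rfl fun χ hχ => by rw [hz χ (by simpa using hχ) g h hh]

theorem IsSNormal.sum_coset_eq_zero {H : Subgroup G} [Fintype H] (hH : S.IsSNormal H)
    {σ : G → ℂ} (hσ : σ ∈ S.supercharsOver H) (g : G) : ∑ h : H, σ (g * h) = 0 := by
  obtain ⟨⟨X, hX, rfl⟩, hker⟩ := hσ
  refine (hH.sigmaChar_coset_dichotomy hX).resolve_right (fun h => hker fun x hx => ?_) g
  rw [← one_mul x]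
  exact h 1 x hx

theorem IsSNormal.sigmaChar_mul_eq {H : Subgroup G} (hH : S.IsSNormal H)
    {X : Set (irrCharacters G)} (hX : X ∈ S.charParts) (hker : (H : Set G) ⊆ charKer (sigmaChar X))
    (g : G) {h : G} (hh : h ∈ H) : sigmaChar X (g * h) = sigmaChar X g := by
  have := Fintype.ofFinite G
  have := Fintype.ofFinite H
  refine (hH.sigmaChar_coset_dichotomy hX).resolve_left (fun h0 => ?_) g h hh
  have h1 := h0 1
  rw [Finset.sum_congr rfl fun (k : H) _ => by rw [one_mul, hker k.2]] at h1
  simp [sigmaChar_one_ne_zero (nonempty_of_mem_charParts hX)] at h1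

/-- Where all of `Irr(S | H)` vanishes, only supercharacters that are constant on cosets of `H`
contribute to a function constant on superclasses, while the others do not contribute to its coset
sum. -/
theorem IsClassFunction.sum_coset {H : Subgroup G} [Fintype H] (hH : S.IsSNormal H) {f : G → ℂ}
    (hf : S.IsClassFunction f) {g : G} (hg : ∀ σ ∈ S.supercharsOver H, σ g = 0) :
    ∑ h : H, f (g * h) = Nat.card H * f g := by
  have := S.finite_charParts
  have := Fintype.ofFinite S.charParts
  obtain ⟨c, rfl⟩ := hf.exists_eq_sum
  simp only [Finset.sum_apply, Pi.smul_apply]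
  rw [Finset.sum_comm, Finset.mul_sum]
  refine Finset.sum_congr rfl fun X _ => ?_
  by_cases hker : (H : Set G) ⊆ charKer (sigmaChar X.1)
  · rw [Finset.sum_congr rfl fun (k : H) _ => by rw [hH.sigmaChar_mul_eq X.2 hker g k.2]]
    simp
  · have hσ : sigmaChar X.1 ∈ S.supercharsOver H := ⟨⟨X.1, X.2, rfl⟩, hker⟩
    rw [← Finset.smul_sum, hH.sum_coset_eq_zero hσ, hg _ hσ]
    simp

/-! ### Vanishing and coset unions -/

theorem IsSNormal.le_vanishingOff {H : Subgroup G} (hH : S.IsSNormal H) :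
    H ≤ S.vanishingOff H := by
  classical
  have := Fintype.ofFinite G
  intro h hh
  by_contra hn
  have h1 : h ≠ 1 := fun e => hn (e ▸ one_mem _)
  -- The indicator function of `1` has sum `1` over the coset `h * H = H`, but vanishes at `h`.
  have key := (isClassFunction_indicator_of_mem_classes S.singleton_one_mem).sum_coset hH
    fun σ hσ => eq_zero_of_notMem_vanishingOff hn hσ
  rw [Finset.sum_eq_single (⟨h, hh⟩⁻¹ : H)] at key
  · simp [h1] at key
  · intro k _ hk
    rw [Set.indicator_of_notMem]
    intro e
    exact hk (Subtype.ext (eq_inv_of_mul_eq_one_right e))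
  · simp

/-- Where all of `Irr(S | H)` vanishes, superclasses are unions of cosets of `H`: the coset sum of
the indicator function of the superclass attains its maximum `|H|`. -/
theorem IsSNormal.mul_mem_of_notMem_vanishingOff {H : Subgroup G} (hH : S.IsSNormal H)
    {K : Set G} (hK : K ∈ S.classes) {g h : G} (hgK : g ∈ K) (hg : g ∉ S.vanishingOff H)
    (hh : h ∈ H) : g * h ∈ K := by
  classical
  have := Fintype.ofFinite G
  have key := (isClassFunction_indicator_of_mem_classes hK).sum_coset hH
    fun σ hσ => eq_zero_of_notMem_vanishingOff hg hσ
  simp only [Set.indicator_apply, hgK, if_true, Pi.one_apply, mul_one, Finset.sum_boole] at key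
  have hcard : #{k : H | g * (k : G) ∈ K} = #(Finset.univ : Finset H) := by
    rw [Finset.card_univ, ← Nat.card_eq_fintype_card]
    exact_mod_cast key
  exact Finset.card_filter_eq_iff.1 hcard ⟨h, hh⟩ (Finset.mem_univ _)

/-- A superclass outside `N` is a union of cosets of `H`, so supercharacters are constant on these
cosets; those in `Irr(S | H)` have vanishing coset sums. -/
theorem IsSNormal.vanishingOff_le {H N : Subgroup G} (hH : S.IsSNormal H)
    (hcoset : ∀ K ∈ S.classes, ∀ g ∈ K, g ∉ N → ∀ h ∈ H, g * h ∈ K) :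
    S.vanishingOff H ≤ N := by
  have := Fintype.ofFinite G
  have := Fintype.ofFinite H
  rw [vanishingOff, Subgroup.closure_le]
  rintro g ⟨σ, hσ, hne⟩
  by_contra hgN
  obtain ⟨K, hK, hgK⟩ := S.exists_mem_classes g
  have h0 := hH.sum_coset_eq_zero hσ g
  obtain ⟨⟨X, hX, rfl⟩, -⟩ := hσ
  rw [Finset.sum_congr rfl fun (k : H) _ =>
    S.sigmaChar_const X hX K hK _ (hcoset K hK g hgK hgN k k.2) g hgK] at h0
  simp [hne] at h0

end ClassFunctions

/-! ### The `Δ`-product -/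

section DeltaProduct

variable {G : Type*} [Group G] {S : SupercharacterTheory G} {H N : Subgroup G}

theorem IsDeltaProduct.mul_mem (hD : S.IsDeltaProduct H N) {K : Set G} (hK : K ∈ S.classes) {g : G}
    (hgK : g ∈ K) (hgN : g ∉ N) {h : G} (hh : h ∈ H) : g * h ∈ K := by
  rw [hD.2] at hK
  rcases hK with ⟨A, -, rfl⟩ | ⟨B, -, -, rfl⟩
  · obtain ⟨a, -, rfl⟩ := hgK
    exact absurd a.2 hgN
  · rwa [Set.mem_preimage, QuotientGroup.mk_mul_of_mem g hh]

theorem image_coe_preimage_coe {K : Set G} (hK : K ⊆ N) :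
    ((↑) : N → G) '' ((↑) ⁻¹' K) = K :=
  Set.image_preimage_eq_of_subset (by simpa using hK)

theorem image_mk_subset_image_mk_iff (hHN : H ≤ N) {K : Set G} :
    (QuotientGroup.mk : G → G ⧸ H) '' K ⊆ (QuotientGroup.mk : G → G ⧸ H) '' (N : Set G) ↔
      K ⊆ N := by
  refine ⟨fun h g hg => ?_, Set.image_mono⟩
  obtain ⟨n, hn, hng⟩ := h ⟨g, hg, rfl⟩
  have := mul_mem hn (hHN (QuotientGroup.eq.1 hng))
  rwa [mul_inv_cancel_left] at this

theorem preimage_image_mk_eq {K : Set G} (hK : ∀ g ∈ K, ∀ h ∈ H, g * h ∈ K) :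
    (QuotientGroup.mk : G → G ⧸ H) ⁻¹' ((QuotientGroup.mk : G → G ⧸ H) '' K) = K := by
  refine (Set.subset_preimage_image _ _).antisymm' ?_
  rintro x ⟨g, hg, hgx⟩
  have := hK g hg _ (QuotientGroup.eq.1 hgx)
  rwa [mul_inv_cancel_left] at this

variable [Finite G]

theorem deltaCompatible (hH : S.IsSNormal H) (hN : S.IsSNormal N) (hHN : H ≤ N) :
    DeltaCompatible H N (S.restrictClasses N) (S.deflateClasses H) where
  le := hHN
  normal_left := hH.normal
  normal_right := hN.normal
  invariant A hA x hx g y hy := by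
    have h := conj_mem_of_mem_classes (S := S) hA (Set.mem_image_of_mem _ hx) g
    rw [← hy] at h
    obtain ⟨z, hz, hzy⟩ := h
    rwa [← Subtype.ext hzy]
  left_union := by
    obtain ⟨𝒦, h𝒦, hH⟩ := hH
    have himg : ∀ K ∈ 𝒦, ((↑) : N → G) '' ((↑) ⁻¹' K) = K := fun K hK =>
      image_coe_preimage_coe (((Set.subset_sUnion_of_mem hK).trans hH.symm.subset).trans hHN)
    refine ⟨(fun K => ((↑) : N → G) ⁻¹' K) '' 𝒦, ?_, ?_⟩
    · rintro _ ⟨K, hK, rfl⟩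
      change _ ∈ S.classes
      rw [himg K hK]
      exact h𝒦 hK
    · ext x
      rw [Set.mem_ofPred_eq, ← SetLike.mem_coe, hH]
      simp
  right_union := by
    obtain ⟨𝒦, h𝒦, hN⟩ := hN
    refine ⟨(fun K => (QuotientGroup.mk : G → G ⧸ H) '' K) '' 𝒦, ?_, ?_⟩
    · rintro _ ⟨K, hK, rfl⟩
      exact ⟨K, h𝒦 hK, rfl⟩
    · rw [hN, Set.sUnion_eq_biUnion, Set.image_iUnion₂, Set.sUnion_image]
  agree := by
    ext B
    constructor
    · rintro ⟨A, hA, rfl⟩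
      refine ⟨⟨_, hA, by rw [Set.image_image]⟩, ?_⟩
      rintro _ ⟨x, -, rfl⟩
      exact ⟨x, x.2, rfl⟩
    · rintro ⟨⟨K, hK, rfl⟩, hB⟩
      have hKN := (image_mk_subset_image_mk_iff hHN).1 hB
      have himg : ((↑) : N → G) '' ((↑) ⁻¹' K) = K :=
        image_coe_preimage_coe hKN
      refine ⟨(↑) ⁻¹' K, ?_, ?_⟩
      · change _ ∈ S.classes
        rwa [himg]
      · conv_rhs => rw [← himg, Set.image_image]

theorem isDeltaProduct_of_mul_mem (hH : S.IsSNormal H) (hN : S.IsSNormal N) (hHN : H ≤ N)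
    (hcoset : ∀ K ∈ S.classes, ∀ g ∈ K, g ∉ N → ∀ h ∈ H, g * h ∈ K) :
    S.IsDeltaProduct H N := by
  have hpre : ∀ K ∈ S.classes, ¬ K ⊆ N →
      (QuotientGroup.mk : G → G ⧸ H) ⁻¹' ((QuotientGroup.mk : G → G ⧸ H) '' K) = K :=
    fun K hK hKN => preimage_image_mk_eq fun g hg =>
      hcoset K hK g hg fun hgN => hKN (hN.subset_of_mem hK hg hgN)
  refine ⟨deltaCompatible hH hN hHN, Set.Subset.antisymm (fun K hK => ?_) ?_⟩
  · by_cases hKN : K ⊆ N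
    · have himg : ((↑) : N → G) '' ((↑) ⁻¹' K) = K :=
        image_coe_preimage_coe hKN
      exact Or.inl ⟨(↑) ⁻¹' K, by change _ ∈ S.classes; rwa [himg], himg.symm⟩
    · exact Or.inr ⟨_, ⟨K, hK, rfl⟩, mt (image_mk_subset_image_mk_iff hHN).1 hKN,
        (hpre K hK hKN).symm⟩
  · rintro _ (⟨A, hA, rfl⟩ | ⟨_, ⟨K, hK, rfl⟩, hKN, rfl⟩)
    · exact hA
    · rwa [hpre K hK (mt (image_mk_subset_image_mk_iff hHN).2 hKN)]

end DeltaProduct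

end SupercharacterTheory

open SupercharacterTheory in
theorem mainTheorem10 {G : Type*} [Group G] [Finite G] (S : SupercharacterTheory G)
    (N : Subgroup G) (hN : S.IsSNormal N) (hN1 : N ≠ ⊥) :
    (∃ H : Subgroup G, S.IsSNormal H ∧ H ≠ ⊥ ∧ H ≤ N ∧ S.IsDeltaProduct H N) ↔
      S.uSubgroup N ≠ ⊥ := by
  constructor
  · rintro ⟨H, hH, hH1, -, hD⟩ hU
    have hV : S.vanishingOff H ≤ N :=
      hH.vanishingOff_le fun K hK g hgK hgN h hh => hD.mul_mem hK hgK hgN hh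
    exact hH1 (le_bot_iff.1 (hU ▸ le_sSup ⟨hH, hV⟩))
  · intro hU
    obtain ⟨H, ⟨hH, hV⟩, hH1⟩ :
        ∃ H ∈ {H | S.IsSNormal H ∧ S.vanishingOff H ≤ N}, H ≠ ⊥ := by
      by_contra! h
      exact hU (sSup_eq_bot.2 h)
    have hHN : H ≤ N := hH.le_vanishingOff.trans hV
    exact ⟨H, hH, hH1, hHN, isDeltaProduct_of_mul_mem hH hN hHN fun K hK g hgK hgN h hh =>
      hH.mul_mem_of_notMem_vanishingOff hK hgK (fun hg => hgN (hV hg)) hh⟩
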